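/- Let $g(x)=-\frac{1}{2\pi}\ln|x|$ on $\mathbb{R}^2$ and let $\Delta=\{(x,x) : x\in\mathbb{R}^2\}$. Let $\omega_0,\rho_0\in L^2(\mathbb{R}^2,\mathbb{R})$ have compact support, let $K\subset\mathbb{R}^2$ be compact, and for every $N\ge 1$ let $\omega_{N,0}\in L^2(\mathbb{R}^2,\mathbb{R})$ have support in $K$ and let $q_1^0,\dots,q_N^0\in K$ (which may depend on $N$) be pairwise distinct; put $\rho_{N,0}=\frac1N\sum_{i=1}^N\delta_{q_i^0}$. Suppose that, as $N\to\infty$, $$\omega_{N,0}\longrightarrow\omega_0 \text{ in } L^2(\mathbb{R}^2),\qquad \rho_{N,0}\overset{\ast}{\rightharpoonup}\rho_0 \text{ in } \mathcal{M}(\mathbb{R}^2),$$ $$\frac{1}{N^2}\sum_{1\le i\ne j\le N} g(q_i^0-q_j^0)\longrightarrow \iint g(x-y)\,\rho_0(x)\rho_0(y)\,\mathrm{d}x\,\mathrm{d}y .$$ Here weak-$*$ convergence in the space $\mathcal{M}(\mathbb{R}^2)$ of finite signed measures is tested against continuous functions vanishing at infinity, and a function in $L^2$ with compact support is identified with the signed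 measure of which it is the density. Then $g(x-y)$ is absolutely integrable on $(\mathbb{R}^2\times\mathbb{R}^2)\setminus\Delta$ with respect to $(\rho_0+\omega_0-\rho_{N,0}-\omega_{N,0})^{\otimes 2}$ for every $N$, and $$\int_{(\mathbb{R}^2\times\mathbb{R}^2)\setminus\Delta} g(x-y)\,(\rho_0+\omega_0-\rho_{N,0}-\omega_{N,0})^{\otimes 2}(\mathrm{d}x\,\mathrm{d}y)\longrightarrow 0\qquad (N\to\infty).$$ -/

import Mathlib

open MeasureTheory Filter Topology
open scoped ZeroAtInfty

noncomputable section

/-- The Euclidean plane. -/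
abbrev Plane : Type := EuclideanSpace ℝ (Fin 2)

/-- The opposite of the Green kernel of the plane, `g(x) = -(1/2π) ln |x|`. -/
def greenKernel (x : Plane) : ℝ := -(1 / (2 * Real.pi)) * Real.log ‖x‖

/-- The (essential) support of the function `f` is contained in the closed set `K`. -/
def EssSupportSubset (f : Plane → ℝ) (K : Set Plane) : Prop :=
  ∀ᵐ x ∂(volume : Measure Plane), x ∉ K → f x = 0

/-- The (essential) support of the function `f` is compact. -/
def HasCompactEssSupport (f : Plane → ℝ) : Prop :=
  ∃ K : Set Plane, IsCompact K ∧ EssSupportSubset f K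

/-- The signed measure `f(x) dx` of an integrable function `f`. -/
def densityMeasure (f : Plane → ℝ) : SignedMeasure Plane :=
  (volume : Measure Plane).withDensityᵥ f

/-- The empirical measure `(1/N) ∑ᵢ δ_{qᵢ}`. -/
def empiricalMeasure {N : ℕ} (q : Fin N → Plane) : SignedMeasure Plane :=
  (1 / (N : ℝ)) • ∑ i : Fin N, VectorMeasure.dirac (q i) (1 : ℝ)

/-- Weak-* convergence of signed measures on the plane, in duality with the continuous functions
vanishing at infinity. -/
def WeakStarTendsto (μ : ℕ → SignedMeasure Plane) (ν : SignedMeasure Plane) : Prop :=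
  ∀ φ : C₀(Plane, ℝ),
    Tendsto (fun N => (μ N).integral (fun x => φ x) (ContinuousLinearMap.lsmul ℝ ℝ)) atTop
      (𝓝 (ν.integral (fun x => φ x) (ContinuousLinearMap.lsmul ℝ ℝ)))

/-- The tensor square `σ ⊗ σ` of a signed measure. -/
def tensorSquare (σ : SignedMeasure Plane) : SignedMeasure (Plane × Plane) :=
  σ.prod σ (ContinuousLinearMap.lsmul ℝ ℝ)

/-- The complement of the diagonal of the plane. -/
def offDiagonal : Set (Plane × Plane) := {p | p.1 ≠ p.2}

/-- `g(x - y)` is absolutely integrable off the diagonal with respect to `σ ⊗ σ`. -/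
def HasFiniteCoulombEnergy (σ : SignedMeasure Plane) : Prop :=
  (tensorSquare σ).IntegrableOn (fun p : Plane × Plane => greenKernel (p.1 - p.2)) offDiagonal

/-- The Coulomb energy of `σ` off the diagonal, `∫_{x ≠ y} g(x - y) (σ ⊗ σ)(dx dy)`. -/
def coulombEnergy (σ : SignedMeasure Plane) : ℝ :=
  ((tensorSquare σ).restrict offDiagonal).integral
    (fun p : Plane × Plane => greenKernel (p.1 - p.2)) (ContinuousLinearMap.lsmul ℝ ℝ)

end

/-! Put `h N = ω₀ - ω N`, which tends to 0 in L². The signed measure is then `f_N dx - e_N`, with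
`f_N = ρ₀ + h N` and `e_N` the empirical measure. Expanding the square gives three terms: the
self-interaction of `f_N`, minus twice the integral of the potential of `f_N` against `e_N`, plus
the discrete energy of the points (`coulombEnergy_density_sub_empirical`). Removing the diagonal
affects only `e_N ⊗ e_N`, since Lebesgue measure has no atoms.

All supports lie in one ball of radius `R`, so g may be cut off at radius `2 * R`, and the truncated
kernel is in L². By Cauchy–Schwarz the potential of an L² function is then bounded, linearly in its
L² norm, and continuous (`continuous_kernelPotential`). Hence `h N` contributes nothing in the
limit, and the potential of `ρ₀` is a legitimate test function for the weak-* convergence, after a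
cutoff. With I the self-interaction of `ρ₀`, the three terms tend to I, -2I and, by hypothesis, I.
-/

open scoped NNReal ENNReal

/-! ### Signed measures with a density: integrals and tensor squares. -/

section SignedMeasureDensity

variable {X : Type*} [MeasurableSpace X]

theorem lsmul_flip_real :
    (ContinuousLinearMap.lsmul ℝ ℝ : ℝ →L[ℝ] ℝ →L[ℝ] ℝ).flip = ContinuousLinearMap.lsmul ℝ ℝ := by
  ext
  simp

theorem integrable_withDensityᵥ_iff {μ : Measure X} {f g : X → ℝ} (hf : Integrable f μ) :
    (μ.withDensityᵥ f).Integrable g ↔ Integrable (fun x => ‖f x‖ * g x) μ := by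
  rw [VectorMeasure.Integrable, Measure.variation_withDensityᵥ hf,
    integrable_withDensity_iff_integrable_smul₀' hf.aestronglyMeasurable.enorm
      (Eventually.of_forall fun x => enorm_lt_top)]
  simp

/-- Integrability refers to the variation `|f| μ`, and `|f| g` is `f g` multiplied by the bounded
measurable function `sign f`. -/
theorem VectorMeasure.integrable_withDensityᵥ {μ : Measure X} {f g : X → ℝ} (hf : Integrable f μ)
    (hfg : Integrable (fun x => f x * g x) μ) : (μ.withDensityᵥ f).Integrable g := by
  rw [integrable_withDensityᵥ_iff hf]
  have hs : AEStronglyMeasurable (fun x => SignType.sign (f x) * (f x * g x)) μ := by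
    refine AEStronglyMeasurable.mul ?_ hfg.aestronglyMeasurable
    have : Measurable fun r : ℝ => ((SignType.sign r : SignType) : ℝ) := by
      have h : (fun r : ℝ => ((SignType.sign r : SignType) : ℝ)) =
          fun r => if 0 < r then 1 else if r < 0 then -1 else 0 := by
        ext r
        rw [sign_apply]
        split_ifs <;> simp
      rw [h]
      exact Measurable.ite measurableSet_Ioi measurable_const
        (Measurable.ite measurableSet_Iio measurable_const measurable_const)
    exact (this.comp_aemeasurable hf.aemeasurable).aestronglyMeasurable
  have h : (fun x => ‖f x‖ * g x) = fun x => SignType.sign (f x) * (f x * g x) := by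
    ext x
    rw [← mul_assoc, sign_mul_self, Real.norm_eq_abs]
  rw [h]
  refine hfg.mono hs (Eventually.of_forall fun x => ?_)
  rw [← mul_assoc, sign_mul_self]
  simp

/-- The integral of a function against the signed measure `f μ`. -/
theorem VectorMeasure.integral_withDensityᵥ {μ : Measure X} {f g : X → ℝ} (hf : Integrable f μ)
    (hfg : Integrable (fun x => f x * g x) μ) :
    (μ.withDensityᵥ f).integral g (ContinuousLinearMap.lsmul ℝ ℝ) = ∫ x, f x * g x ∂μ := by
  have hfin := isFiniteMeasure_withDensity_ofReal hf.2
  have hfin' := isFiniteMeasure_withDensity_ofReal hf.neg.2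
  have hnorm := (integrable_withDensityᵥ_iff hf).1 (VectorMeasure.integrable_withDensityᵥ hf hfg)
  -- The positive part is `(|f| + f) / 2`, the negative part `(|f| - f) / 2`.
  have hpos : Integrable (fun x => max (f x) 0 * g x) μ := by
    refine ((hnorm.add hfg).const_mul (1 / 2)).congr (Eventually.of_forall fun x => ?_)
    rcases le_total 0 (f x) with h | h
    · simp [h, abs_of_nonneg h]; ring
    · simp [h, abs_of_nonpos h]
  have hneg : Integrable (fun x => max (-f x) 0 * g x) μ := by
    refine ((hnorm.sub hfg).const_mul (1 / 2)).congr (Eventually.of_forall fun x => ?_)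
    rcases le_total 0 (f x) with h | h
    · simp [h, abs_of_nonneg h]
    · simp [h, abs_of_nonpos h]; ring
  have hm : AEMeasurable (fun x => ENNReal.ofReal (f x)) μ := hf.aemeasurable.ennreal_ofReal
  have hm' : AEMeasurable (fun x => ENNReal.ofReal (-f x)) μ := hf.aemeasurable.neg.ennreal_ofReal
  have hlt : ∀ᵐ x ∂μ, ENNReal.ofReal (f x) < ∞ := Eventually.of_forall fun x => by simp
  have hlt' : ∀ᵐ x ∂μ, ENNReal.ofReal (-f x) < ∞ := Eventually.of_forall fun x => by simp
  rw [withDensityᵥ_eq_withDensity_pos_part_sub_withDensity_neg_part hf,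
    VectorMeasure.integral_sub_vectorMeasure]
  · rw [← lsmul_flip_real, VectorMeasure.integral_toSignedMeasure,
      VectorMeasure.integral_toSignedMeasure, integral_withDensity_eq_integral_toReal_smul₀ hm hlt,
      integral_withDensity_eq_integral_toReal_smul₀ hm' hlt', ← integral_sub]
    · refine integral_congr_ae (Eventually.of_forall fun x => ?_)
      rcases le_total 0 (f x) with h | h <;> simp [h, ENNReal.toReal_ofReal']
    · simpa [ENNReal.toReal_ofReal'] using hpos
    · simpa [ENNReal.toReal_ofReal'] using hneg
  · rw [VectorMeasure.Integrable, Measure.variation_toSignedMeasure,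
      integrable_withDensity_iff_integrable_smul₀' hm hlt]
    simpa [ENNReal.toReal_ofReal'] using hpos
  · rw [VectorMeasure.Integrable, Measure.variation_toSignedMeasure,
      integrable_withDensity_iff_integrable_smul₀' hm' hlt']
    simpa [ENNReal.toReal_ofReal'] using hneg

theorem restrict_withDensityᵥ {μ : Measure X} {f : X → ℝ} (hf : Integrable f μ) {s : Set X}
    (hs : MeasurableSet s) : (μ.withDensityᵥ f).restrict s = (μ.restrict s).withDensityᵥ f := by
  ext t ht
  rw [VectorMeasure.restrict_apply _ hs ht, withDensityᵥ_apply hf (ht.inter hs),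
    withDensityᵥ_apply hf.integrableOn ht, Measure.restrict_restrict ht]

/-- The tensor square of a difference of two signed measures with densities. -/
theorem prod_sub_withDensityᵥ {μ ν : Measure X} [SFinite μ] [SFinite ν] {f h : X → ℝ}
    (hf : Integrable f μ) (hh : Integrable h ν) :
    (μ.withDensityᵥ f - ν.withDensityᵥ h).prod (μ.withDensityᵥ f - ν.withDensityᵥ h)
        (ContinuousLinearMap.lsmul ℝ ℝ) =
      (μ.prod μ).withDensityᵥ (fun p => f p.1 * f p.2)
        - (μ.prod ν).withDensityᵥ (fun p => f p.1 * h p.2)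
        - (ν.prod μ).withDensityᵥ (fun p => h p.1 * f p.2)
        + (ν.prod ν).withDensityᵥ (fun p => h p.1 * h p.2) := by
  -- A product of signed measures is determined by its values on rectangles, where each term
  -- factors.
  refine VectorMeasure.prod_eq_of_forall_apply_prod fun s t hs ht => ?_
  simp only [_root_.add_apply, _root_.sub_apply]
  rw [withDensityᵥ_apply (hf.mul_prod hf) (hs.prod ht),
    withDensityᵥ_apply (hf.mul_prod hh) (hs.prod ht),
    withDensityᵥ_apply (hh.mul_prod hf) (hs.prod ht),
    withDensityᵥ_apply (hh.mul_prod hh) (hs.prod ht),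
    withDensityᵥ_apply hf hs, withDensityᵥ_apply hf ht, withDensityᵥ_apply hh hs,
    withDensityᵥ_apply hh ht, setIntegral_prod_mul, setIntegral_prod_mul, setIntegral_prod_mul,
    setIntegral_prod_mul]
  simp only [ContinuousLinearMap.lsmul_apply, smul_eq_mul]
  ring

end SignedMeasureDensity

/-! ### Potentials of L² functions for an L² kernel. -/

section L2Potential

/-- The potential `x ↦ ∫ G(x - y) f(y) dy` of `f` with respect to the kernel `G`. -/
noncomputable def kernelPotential (G f : Plane → ℝ) (x : Plane) : ℝ := ∫ y, G (x - y) * f y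

variable {G f h : Plane → ℝ}

theorem memLp_comp_sub_left {p : ℝ≥0∞} (hG : MemLp G p) (x : Plane) :
    MemLp (fun y => G (x - y)) p :=
  hG.comp_measurePreserving (Measure.measurePreserving_sub_left volume x)

theorem integrable_comp_sub_left_mul (hG : MemLp G 2) (hf : MemLp f 2) (x : Plane) :
    Integrable fun y => G (x - y) * f y :=
  (memLp_comp_sub_left hG x).integrable_mul hf

theorem integral_abs_mul_le {u v : Plane → ℝ} (hu : MemLp u 2) (hv : MemLp v 2) :
    ∫ y, ‖u y * v y‖ ≤ (eLpNorm u 2).toReal * (eLpNorm v 2).toReal := by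
  have h := eLpNorm_smul_le_mul_eLpNorm (p := 2) (q := 2) (r := 1) hv.1 hu.1
  have h' := ENNReal.toReal_mono (ENNReal.mul_ne_top hu.2.ne hv.2.ne) h
  rw [ENNReal.toReal_mul] at h'
  refine le_trans (le_of_eq ?_) h'
  rw [eLpNorm_one_eq_lintegral_enorm]
  exact integral_norm_eq_lintegral_enorm (hu.1.mul hv.1)

/-- Cauchy–Schwarz; the bound is uniform in `x` because `y ↦ x - y` preserves Lebesgue measure. -/
theorem integral_abs_comp_sub_left_mul_le (hG : MemLp G 2) (hf : MemLp f 2) (x : Plane) :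
    ∫ y, ‖G (x - y) * f y‖ ≤ (eLpNorm G 2).toReal * (eLpNorm f 2).toReal := by
  rw [← eLpNorm_comp_measurePreserving hG.1 (Measure.measurePreserving_sub_left volume x)]
  exact integral_abs_mul_le (memLp_comp_sub_left hG x) hf

theorem abs_kernelPotential_le (hG : MemLp G 2) (hf : MemLp f 2) (x : Plane) :
    |kernelPotential G f x| ≤ (eLpNorm G 2).toReal * (eLpNorm f 2).toReal :=
  (norm_integral_le_integral_norm _).trans (integral_abs_comp_sub_left_mul_le hG hf x)

theorem kernelPotential_add (hG : MemLp G 2) (hf : MemLp f 2) (hh : MemLp h 2) (x : Plane) :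
    kernelPotential G (f + h) x = kernelPotential G f x + kernelPotential G h x := by
  rw [kernelPotential, kernelPotential, kernelPotential, ← integral_add
    (integrable_comp_sub_left_mul hG hf x) (integrable_comp_sub_left_mul hG hh x)]
  simp [mul_add]

theorem kernelPotential_sub_kernel {G' : Plane → ℝ} (hG : MemLp G 2) (hG' : MemLp G' 2)
    (hf : MemLp f 2) (x : Plane) :
    kernelPotential (G - G') f x = kernelPotential G f x - kernelPotential G' f x := by
  rw [kernelPotential, kernelPotential, kernelPotential, ← integral_sub
    (integrable_comp_sub_left_mul hG hf x) (integrable_comp_sub_left_mul hG' hf x)]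
  simp [sub_mul]

/-- The convolution of two square integrable functions is continuous. -/
theorem continuous_kernelPotential (hG : MemLp G 2) (hf : MemLp f 2) :
    Continuous (kernelPotential G f) := by
  -- Approximating `G` in L² by continuous compactly supported kernels makes the potentials converge
  -- uniformly.
  refine continuous_of_uniform_approx_of_continuous fun u hu => ?_
  obtain ⟨ε, hε, hεu⟩ := Metric.mem_uniformity_dist.1 hu
  obtain ⟨A, hA'⟩ : ∃ A, A = (eLpNorm f 2).toReal := ⟨_, rfl⟩
  have hA : 0 ≤ A := hA' ▸ ENNReal.toReal_nonneg
  -- `A + 1` rather than `A`, since `f` may vanish.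
  have hδ : 0 < ε / (A + 1) := by positivity
  obtain ⟨G', hG'c, hG'le, hG'cont, hG'⟩ := hG.exists_hasCompactSupport_eLpNorm_sub_le (by simp)
    (ε := ENNReal.ofReal (ε / (A + 1))) (by simpa using hδ)
  refine ⟨kernelPotential G' f, ?_, fun x => hεu ?_⟩
  · have h := hG'c.continuous_convolution_right (ContinuousLinearMap.lsmul ℝ ℝ)
      (hf.locallyIntegrable (by norm_num)) hG'cont (μ := (volume : Measure Plane))
    refine h.congr fun x => ?_
    simp only [kernelPotential, convolution, ContinuousLinearMap.lsmul_apply, smul_eq_mul,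
      mul_comm (f _)]
  · rw [Real.dist_eq, ← kernelPotential_sub_kernel hG hG' hf]
    refine (abs_kernelPotential_le (hG.sub hG') hf x).trans_lt ?_
    have h1 : (eLpNorm (G - G') 2).toReal ≤ ε / (A + 1) :=
      ENNReal.toReal_le_of_le_ofReal hδ.le hG'le
    rw [← hA']
    refine (mul_le_mul_of_nonneg_right h1 hA).trans_lt ?_
    rw [div_mul_eq_mul_div, div_lt_iff₀ (by positivity)]
    linarith

theorem integrable_mul_kernelPotential {ν : Measure Plane} (hG : MemLp G 2) (hf : MemLp f 2)
    (hh : Integrable h ν) : Integrable (fun x => h x * kernelPotential G f x) ν :=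
  hh.mul_bdd (continuous_kernelPotential hG hf).aestronglyMeasurable
    (Eventually.of_forall fun x => abs_kernelPotential_le hG hf x)

theorem abs_integral_mul_kernelPotential_le {ν : Measure Plane} (hG : MemLp G 2) (hf : MemLp f 2)
    (hh : Integrable h ν) : |∫ x, h x * kernelPotential G f x ∂ν| ≤
      (∫ x, ‖h x‖ ∂ν) * ((eLpNorm G 2).toReal * (eLpNorm f 2).toReal) := by
  rw [← integral_mul_const]
  refine (norm_integral_le_integral_norm _).trans (integral_mono
    (integrable_mul_kernelPotential hG hf hh).norm (hh.norm.mul_const _) fun x => ?_)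
  simp only [norm_mul]
  gcongr
  exact abs_kernelPotential_le hG hf x

/-- Tonelli with the uniform bound on the inner integral. Only one factor must be Lebesgue measure:
`ν` will be Lebesgue or empirical. -/
theorem integrable_prod_kernel {ν : Measure Plane} [SFinite ν] (hGm : Measurable G)
    (hG : MemLp G 2) (hf : MemLp f 2) (hh : Integrable h ν) :
    Integrable (fun p : Plane × Plane => h p.1 * f p.2 * G (p.1 - p.2)) (ν.prod volume) := by
  have hm : AEStronglyMeasurable (fun p : Plane × Plane => h p.1 * f p.2 * G (p.1 - p.2))
      (ν.prod volume) :=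
    (hh.1.comp_fst.mul hf.1.comp_snd).mul
      (hGm.comp (measurable_fst.sub measurable_snd)).aestronglyMeasurable
  rw [integrable_prod_iff hm]
  refine ⟨Eventually.of_forall fun x => ?_, ?_⟩
  · refine ((integrable_comp_sub_left_mul hG hf x).const_mul (h x)).congr
      (Eventually.of_forall fun y => ?_)
    simp only
    ring
  · refine (hh.norm.mul_const ((eLpNorm G 2).toReal * (eLpNorm f 2).toReal)).mono
      hm.norm.integral_prod_right' (Eventually.of_forall fun x => ?_)
    have h1 : ∀ y, ‖h x * f y * G (x - y)‖ = ‖h x‖ * ‖G (x - y) * f y‖ := fun y => by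
      simp only [norm_mul]; ring
    simp only [h1, integral_const_mul]
    have h0 : 0 ≤ ∫ y, ‖G (x - y) * f y‖ := integral_nonneg fun y => norm_nonneg _
    rw [Real.norm_of_nonneg (mul_nonneg (norm_nonneg _) h0), norm_mul, norm_norm]
    refine (mul_le_mul_of_nonneg_left ?_ (norm_nonneg _)).trans (mul_le_mul_of_nonneg_left
      (le_abs_self _) (norm_nonneg _))
    exact integral_abs_comp_sub_left_mul_le hG hf x

theorem integral_prod_kernel {ν : Measure Plane} [SFinite ν] (hGm : Measurable G)
    (hG : MemLp G 2) (hf : MemLp f 2) (hh : Integrable h ν) :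
    ∫ p : Plane × Plane, h p.1 * f p.2 * G (p.1 - p.2) ∂(ν.prod volume) =
      ∫ x, h x * kernelPotential G f x ∂ν := by
  rw [integral_prod _ (integrable_prod_kernel hGm hG hf hh)]
  refine integral_congr_ae (Eventually.of_forall fun x => ?_)
  simp only [kernelPotential]
  rw [← integral_const_mul]
  congr with y
  ring

end L2Potential

/-! ### Local square integrability of the logarithm. -/

section GreenKernel

theorem measurable_greenKernel : Measurable greenKernel := by
  unfold greenKernel
  fun_prop

theorem greenKernel_sub_comm (x y : Plane) : greenKernel (x - y) = greenKernel (y - x) := by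
  rw [greenKernel, greenKernel, norm_sub_rev]

/-- On r > 0 the integrand equals `4 (√r log √r)²`, which is continuous up to 0 because `t log t`
is. -/
theorem integrableOn_mul_log_sq (R : ℝ) :
    IntegrableOn (fun r : ℝ => r * Real.log r ^ 2) (Set.Ioc 0 R) := by
  have hc : Continuous fun r : ℝ => 4 * (√r * Real.log √r) ^ 2 := by
    have h := Real.continuous_mul_log.comp Real.continuous_sqrt
    exact (h.pow 2).const_mul 4
  refine (hc.integrableOn_Ioc (a := 0) (b := R)).congr_fun (fun r hr => ?_) measurableSet_Ioc
  simp only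
  rw [Real.log_sqrt hr.1.le, mul_pow, Real.sq_sqrt hr.1.le]
  ring

/-- The Green kernel, cut off outside of the closed ball of radius `R`. -/
noncomputable def truncatedGreenKernel (R : ℝ) : Plane → ℝ := (Metric.closedBall 0 R).indicator greenKernel

theorem measurable_truncatedGreenKernel (R : ℝ) : Measurable (truncatedGreenKernel R) :=
  measurable_greenKernel.indicator measurableSet_closedBall

/-- The Green kernel of the plane is locally square integrable. -/
theorem memLp_truncatedGreenKernel (R : ℝ) : MemLp (truncatedGreenKernel R) 2 := by
  rw [memLp_two_iff_integrable_sq (measurable_truncatedGreenKernel R).aestronglyMeasurable]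
  have h : (fun x => truncatedGreenKernel R x ^ 2) = fun x : Plane =>
      (Set.Iic R).indicator (fun r => (1 / (2 * Real.pi)) ^ 2 * Real.log r ^ 2) ‖x‖ := by
    ext x
    by_cases hx : ‖x‖ ≤ R
    · simp [truncatedGreenKernel, hx, greenKernel, mul_pow]
    · simp [truncatedGreenKernel, hx]
  -- Polar coordinates: the Jacobian r tames the squared logarithm.
  rw [h, integrable_fun_norm_addHaar]
  have h2 : (fun y : ℝ => y ^ (Module.finrank ℝ Plane - 1) •
      (Set.Iic R).indicator (fun r => (1 / (2 * Real.pi)) ^ 2 * Real.log r ^ 2) y) =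
      (Set.Iic R).indicator fun y => (1 / (2 * Real.pi)) ^ 2 * (y * Real.log y ^ 2) := by
    ext y
    by_cases hy : y ≤ R
    · simp [hy]; ring
    · simp [hy]
  rw [h2, IntegrableOn, integrable_indicator_iff measurableSet_Iic, IntegrableOn,
    Measure.restrict_restrict measurableSet_Iic, Set.inter_comm, Set.Ioi_inter_Iic]
  exact (integrableOn_mul_log_sq R).const_mul _

end GreenKernel

/-! ### The empirical measure as a positive measure. -/

section PositiveEmpiricalMeasure

variable {N : ℕ} (q : Fin N → Plane)

/-- The empirical measure `(1/N) ∑ᵢ δ_{qᵢ}`, as a positive measure. -/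
noncomputable def posEmpiricalMeasure : Measure Plane :=
  (N : ℝ≥0)⁻¹ • ∑ i : Fin N, Measure.dirac (q i)

instance : IsFiniteMeasure (posEmpiricalMeasure q) := by
  unfold posEmpiricalMeasure
  infer_instance

theorem integrable_posEmpiricalMeasure (f : Plane → ℝ) : Integrable f (posEmpiricalMeasure q) :=
  Integrable.smul_measure_nnreal
    (integrable_finsetSum_measure.2 fun i _ => integrable_dirac (by simp))

theorem integral_posEmpiricalMeasure (f : Plane → ℝ) :
    ∫ x, f x ∂(posEmpiricalMeasure q) = (N : ℝ)⁻¹ * ∑ i, f (q i) := by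
  rw [posEmpiricalMeasure, integral_smul_nnreal_measure,
    integral_finsetSum_measure fun i _ => integrable_dirac (by simp)]
  simp [NNReal.smul_def]

theorem ae_posEmpiricalMeasure {p : Plane → Prop} (hp : ∀ i, p (q i)) :
    ∀ᵐ x ∂(posEmpiricalMeasure q), p x := by
  refine Measure.ae_smul_measure ?_ _
  rw [← Measure.sum_fintype, Measure.ae_sum_iff]
  intro i
  rw [ae_dirac_eq]
  exact hp i

theorem empiricalMeasure_eq_toSignedMeasure :
    empiricalMeasure q = (posEmpiricalMeasure q).toSignedMeasure := by
  ext s hs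
  rw [Measure.toSignedMeasure_apply_measurable hs, ← integral_indicator_one hs,
    integral_posEmpiricalMeasure, empiricalMeasure, _root_.smul_apply, _root_.sum_apply]
  simp only [one_div, smul_eq_mul]
  congr 2 with i
  by_cases h : q i ∈ s <;> simp [h, hs]

/-- Puts the point masses in the form required by `prod_sub_withDensityᵥ`. -/
theorem empiricalMeasure_eq_withDensityᵥ :
    empiricalMeasure q = (posEmpiricalMeasure q).withDensityᵥ fun _ => 1 := by
  ext s hs
  rw [empiricalMeasure_eq_toSignedMeasure, Measure.toSignedMeasure_apply_measurable hs,
    withDensityᵥ_apply (integrable_const 1) hs]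
  simp

theorem integrable_prod_posEmpiricalMeasure {Φ : Plane × Plane → ℝ} (hΦ : Measurable Φ) :
    Integrable Φ ((posEmpiricalMeasure q).prod (posEmpiricalMeasure q)) := by
  rw [integrable_prod_iff hΦ.aestronglyMeasurable]
  exact ⟨Eventually.of_forall fun x => integrable_posEmpiricalMeasure q _,
    integrable_posEmpiricalMeasure q _⟩

theorem measurableSet_offDiagonal : MeasurableSet offDiagonal :=
  (measurableSet_eq_fun measurable_fst measurable_snd).compl

theorem measurable_greenKernel_sub :
    Measurable fun p : Plane × Plane => greenKernel (p.1 - p.2) :=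
  measurable_greenKernel.comp (measurable_fst.sub measurable_snd)

theorem setIntegral_offDiagonal_posEmpiricalMeasure (hq : Function.Injective q) :
    ∫ p in offDiagonal, greenKernel (p.1 - p.2)
        ∂((posEmpiricalMeasure q).prod (posEmpiricalMeasure q)) =
      1 / (N : ℝ) ^ 2 *
        ∑ p ∈ (Finset.univ : Finset (Fin N)).offDiag, greenKernel (q p.1 - q p.2) := by
  rw [← integral_indicator measurableSet_offDiagonal, integral_prod _
    (integrable_prod_posEmpiricalMeasure q
      (measurable_greenKernel_sub.indicator measurableSet_offDiagonal))]
  simp only [integral_posEmpiricalMeasure]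
  rw [← Finset.mul_sum, ← mul_assoc, ← Finset.sum_product', ← mul_inv, ← sq, one_div]
  congr 1
  have hfilter : (Finset.univ : Finset (Fin N)).offDiag =
      (Finset.univ ×ˢ Finset.univ).filter fun p : Fin N × Fin N => p.1 ≠ p.2 := by
    ext p
    simp
  rw [hfilter, Finset.sum_filter]
  refine Finset.sum_congr rfl fun p _ => ?_
  by_cases h : p.1 = p.2
  · simp [h, offDiagonal]
  · have : q p.1 ≠ q p.2 := fun h' => h (hq h')
    simp [h, this, offDiagonal]

end PositiveEmpiricalMeasure

/-! ### Expansion of the off-diagonal energy. -/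

section Energy

variable {R : ℝ} {f h : Plane → ℝ} {ν : Measure Plane}

theorem truncatedGreenKernel_eq {x y : Plane} (hx : x ∈ Metric.closedBall (0 : Plane) R)
    (hy : y ∈ Metric.closedBall (0 : Plane) R) :
    truncatedGreenKernel (2 * R) (x - y) = greenKernel (x - y) := by
  refine Set.indicator_of_mem ?_ _
  rw [mem_closedBall_zero_iff] at *
  linarith [norm_sub_le x y]

theorem ae_mul_greenKernel_eq [SFinite ν] (hf : EssSupportSubset f (Metric.closedBall 0 R))
    (hh : ∀ᵐ x ∂ν, x ∉ Metric.closedBall 0 R → h x = 0) :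
    (fun p : Plane × Plane => h p.1 * f p.2 * truncatedGreenKernel (2 * R) (p.1 - p.2))
      =ᵐ[ν.prod volume] fun p => h p.1 * f p.2 * greenKernel (p.1 - p.2) := by
  have hf' : ∀ᵐ p : Plane × Plane ∂(ν.prod volume), p.2 ∉ Metric.closedBall 0 R → f p.2 = 0 :=
    Measure.quasiMeasurePreserving_snd.ae hf
  have hh' : ∀ᵐ p : Plane × Plane ∂(ν.prod volume), p.1 ∉ Metric.closedBall 0 R → h p.1 = 0 :=
    Measure.quasiMeasurePreserving_fst.ae hh
  filter_upwards [hf', hh'] with p hp hp'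
  by_cases h1 : p.1 ∈ Metric.closedBall (0 : Plane) R
  · by_cases h2 : p.2 ∈ Metric.closedBall (0 : Plane) R
    · rw [truncatedGreenKernel_eq h1 h2]
    · simp [hp h2]
  · simp [hp' h1]

theorem integrable_mul_greenKernel [SFinite ν] (hf2 : MemLp f 2)
    (hf : EssSupportSubset f (Metric.closedBall 0 R)) (hhi : Integrable h ν)
    (hh : ∀ᵐ x ∂ν, x ∉ Metric.closedBall 0 R → h x = 0) :
    Integrable (fun p : Plane × Plane => h p.1 * f p.2 * greenKernel (p.1 - p.2))
      (ν.prod volume) :=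
  (integrable_prod_kernel (measurable_truncatedGreenKernel _) (memLp_truncatedGreenKernel _) hf2
    hhi).congr (ae_mul_greenKernel_eq hf hh)

theorem integral_mul_greenKernel [SFinite ν] (hf2 : MemLp f 2)
    (hf : EssSupportSubset f (Metric.closedBall 0 R)) (hhi : Integrable h ν)
    (hh : ∀ᵐ x ∂ν, x ∉ Metric.closedBall 0 R → h x = 0) :
    ∫ p : Plane × Plane, h p.1 * f p.2 * greenKernel (p.1 - p.2) ∂(ν.prod volume) =
      ∫ x, h x * kernelPotential (truncatedGreenKernel (2 * R)) f x ∂ν := by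
  rw [← integral_congr_ae (ae_mul_greenKernel_eq hf hh), integral_prod_kernel
    (measurable_truncatedGreenKernel _) (memLp_truncatedGreenKernel _) hf2 hhi]

/-- Each slice of the diagonal is a single point, hence Lebesgue-null. -/
theorem restrict_offDiagonal_prod_volume [SFinite ν] :
    (ν.prod (volume : Measure Plane)).restrict offDiagonal = ν.prod volume := by
  refine Measure.restrict_eq_self_of_ae_mem ?_
  rw [ae_iff]
  refine (Measure.measure_prod_null measurableSet_offDiagonal.compl).2
    (Eventually.of_forall fun x => ?_)
  have : Prod.mk x ⁻¹' offDiagonalᶜ = {x} := by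
    ext y
    simp [offDiagonal, eq_comm]
  simp [this]

theorem restrict_offDiagonal_volume_prod [SFinite ν] :
    ((volume : Measure Plane).prod ν).restrict offDiagonal = volume.prod ν := by
  refine Measure.restrict_eq_self_of_ae_mem ?_
  have h : ∀ᵐ p ∂(ν.prod (volume : Measure Plane)), p ∈ offDiagonal := by
    rw [← restrict_offDiagonal_prod_volume]
    exact ae_restrict_mem measurableSet_offDiagonal
  filter_upwards [(Measure.measurePreserving_swap
    (μ := (volume : Measure Plane)) (ν := ν)).quasiMeasurePreserving.ae h] with p hp
  exact Ne.symm hp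

theorem MeasureTheory.MemLp.integrable_of_essSupportSubset (hf2 : MemLp f 2)
    (hf : EssSupportSubset f (Metric.closedBall 0 R)) : Integrable f := by
  have h : IntegrableOn f (Metric.closedBall 0 R) := by
    have : IsFiniteMeasure (volume.restrict (Metric.closedBall (0 : Plane) R)) :=
      isFiniteMeasure_restrict.2 measure_closedBall_lt_top.ne
    exact (hf2.restrict _).integrable (by norm_num)
  refine ((integrable_indicator_iff measurableSet_closedBall).2 h).congr ?_
  filter_upwards [hf] with x hx
  by_cases hxR : x ∈ Metric.closedBall (0 : Plane) R
  · exact Set.indicator_of_mem hxR f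
  · rw [Set.indicator_of_notMem hxR, hx hxR]

/-- Cauchy–Schwarz against the indicator of the ball; it turns L² convergence with a common support
into L¹ convergence. -/
theorem integral_norm_le_of_essSupportSubset (hf2 : MemLp f 2)
    (hf : EssSupportSubset f (Metric.closedBall 0 R)) :
    ∫ x, ‖f x‖ ≤ (eLpNorm ((Metric.closedBall (0 : Plane) R).indicator fun _ => (1 : ℝ)) 2).toReal
      * (eLpNorm f 2).toReal := by
  have h1 : MemLp ((Metric.closedBall (0 : Plane) R).indicator fun _ => (1 : ℝ)) 2 :=
    memLp_indicator_const 2 measurableSet_closedBall 1 (Or.inr measure_closedBall_lt_top.ne)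
  refine le_trans (le_of_eq (integral_congr_ae ?_)) (integral_abs_mul_le h1 hf2)
  filter_upwards [hf] with x hx
  by_cases h : x ∈ Metric.closedBall (0 : Plane) R
  · simp [Set.indicator_of_mem h]
  · simp [hx h]

/-- The off-diagonal energy of `f dx - (1/N) ∑ᵢ δ_{qᵢ}` is finite, and is the sum of the
self-interaction of `f`, the interaction of `f` with the points and the interaction of the
points. -/
theorem coulombEnergy_density_sub_empirical {N : ℕ} {q : Fin N → Plane} (hf2 : MemLp f 2)
    (hf : EssSupportSubset f (Metric.closedBall 0 R)) (hq : Function.Injective q)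
    (hqR : ∀ i, q i ∈ Metric.closedBall 0 R) :
    HasFiniteCoulombEnergy (densityMeasure f - empiricalMeasure q) ∧
    coulombEnergy (densityMeasure f - empiricalMeasure q) =
      (∫ x, f x * kernelPotential (truncatedGreenKernel (2 * R)) f x)
      - 2 * (∫ x, kernelPotential (truncatedGreenKernel (2 * R)) f x ∂(posEmpiricalMeasure q))
      + 1 / (N : ℝ) ^ 2 *
        ∑ p ∈ (Finset.univ : Finset (Fin N)).offDiag, greenKernel (q p.1 - q p.2) := by
  set e := posEmpiricalMeasure q
  have hfi := hf2.integrable_of_essSupportSubset hf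
  have h1 : Integrable (fun _ => (1 : ℝ)) e := integrable_const 1
  have hone : ∀ᵐ x ∂e, x ∉ Metric.closedBall (0 : Plane) R → (1 : ℝ) = 0 :=
    ae_posEmpiricalMeasure q fun i hi => absurd (hqR i) hi
  have iff := integrable_mul_greenKernel hf2 hf hfi hf
  have ief := integrable_mul_greenKernel hf2 hf h1 hone
  have ife : Integrable (fun p : Plane × Plane => f p.1 * 1 * greenKernel (p.1 - p.2))
      (volume.prod e) := by
    refine ief.swap.congr (Eventually.of_forall fun p => ?_)
    simp [greenKernel_sub_comm p.2 p.1]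
  have iee : Integrable (fun p : Plane × Plane => 1 * 1 * greenKernel (p.1 - p.2))
      ((e.prod e).restrict offDiagonal) :=
    (integrable_prod_posEmpiricalMeasure q (measurable_greenKernel_sub.const_mul _)).integrableOn
  have vff := integral_mul_greenKernel hf2 hf hfi hf
  have vef := integral_mul_greenKernel hf2 hf h1 hone
  have vfe : ∫ p : Plane × Plane, f p.1 * 1 * greenKernel (p.1 - p.2) ∂(volume.prod e) =
      ∫ x, 1 * kernelPotential (truncatedGreenKernel (2 * R)) f x ∂e := by
    rw [← vef, ← integral_prod_swap]
    refine integral_congr_ae (Eventually.of_forall fun p => ?_)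
    simp [greenKernel_sub_comm p.2 p.1]
  -- The restriction survives only on `e.prod e`, the one product that can charge the diagonal.
  have hdecomp : (tensorSquare (densityMeasure f - empiricalMeasure q)).restrict offDiagonal =
      (volume.prod volume).withDensityᵥ (fun p : Plane × Plane => f p.1 * f p.2)
        - (volume.prod e).withDensityᵥ (fun p : Plane × Plane => f p.1 * 1)
        - (e.prod volume).withDensityᵥ (fun p : Plane × Plane => 1 * f p.2)
        + ((e.prod e).restrict offDiagonal).withDensityᵥ (fun _ : Plane × Plane => 1 * 1) := by
    rw [tensorSquare, empiricalMeasure_eq_withDensityᵥ, densityMeasure,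
      prod_sub_withDensityᵥ hfi h1, VectorMeasure.restrict_add, VectorMeasure.restrict_sub,
      VectorMeasure.restrict_sub, restrict_withDensityᵥ (hfi.mul_prod hfi) measurableSet_offDiagonal,
      restrict_withDensityᵥ (hfi.mul_prod h1) measurableSet_offDiagonal,
      restrict_withDensityᵥ (h1.mul_prod hfi) measurableSet_offDiagonal,
      restrict_withDensityᵥ (h1.mul_prod h1) measurableSet_offDiagonal,
      restrict_offDiagonal_prod_volume, restrict_offDiagonal_prod_volume,
      restrict_offDiagonal_volume_prod]
  have kff := VectorMeasure.integrable_withDensityᵥ (hfi.mul_prod hfi) iff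
  have kfe := VectorMeasure.integrable_withDensityᵥ (hfi.mul_prod h1) ife
  have kef := VectorMeasure.integrable_withDensityᵥ (h1.mul_prod hfi) ief
  have kee := VectorMeasure.integrable_withDensityᵥ (h1.mul_prod h1).integrableOn iee
  constructor
  · rw [HasFiniteCoulombEnergy, VectorMeasure.IntegrableOn, hdecomp]
    exact ((kff.sub_vectorMeasure kfe).sub_vectorMeasure kef).add_vectorMeasure kee
  · rw [coulombEnergy, hdecomp, VectorMeasure.integral_add_vectorMeasure
        ((kff.sub_vectorMeasure kfe).sub_vectorMeasure kef) kee,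
      VectorMeasure.integral_sub_vectorMeasure (kff.sub_vectorMeasure kfe) kef,
      VectorMeasure.integral_sub_vectorMeasure kff kfe,
      VectorMeasure.integral_withDensityᵥ (hfi.mul_prod hfi) iff,
      VectorMeasure.integral_withDensityᵥ (hfi.mul_prod h1) ife,
      VectorMeasure.integral_withDensityᵥ (h1.mul_prod hfi) ief,
      VectorMeasure.integral_withDensityᵥ (h1.mul_prod h1).integrableOn iee, vff, vfe, vef]
    simp only [one_mul]
    rw [setIntegral_offDiagonal_posEmpiricalMeasure q hq]
    ring

end Energy

/-! ### Passage to the limit in each term. -/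

section Limit

variable {R : ℝ} {f : Plane → ℝ}

theorem EssSupportSubset.mono {K L : Set Plane} (hf : EssSupportSubset f K) (hKL : K ⊆ L) :
    EssSupportSubset f L := by
  filter_upwards [hf] with x hx hxL
  exact hx fun h => hxL (hKL h)

/-- Weak-* convergence of compactly supported empirical measures towards a compactly supported
density can be tested against arbitrary continuous functions. -/
theorem WeakStarTendsto.tendsto_integral_posEmpiricalMeasure {q : (N : ℕ) → Fin N → Plane}
    (hlim : WeakStarTendsto (fun N => empiricalMeasure (q N)) (densityMeasure f))
    (hfi : Integrable f) (hf : EssSupportSubset f (Metric.closedBall 0 R))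
    (hqR : ∀ N i, q N i ∈ Metric.closedBall 0 R) {u : Plane → ℝ} (hu : Continuous u) :
    Tendsto (fun N => ∫ x, u x ∂(posEmpiricalMeasure (q N))) atTop (𝓝 (∫ x, f x * u x)) := by
  -- Multiplying `u` by a cutoff equal to 1 on the ball gives an admissible test function and
  -- changes neither integral.
  obtain ⟨χ, hχ1, -, hχc, -⟩ := exists_continuous_one_zero_of_isCompact
    (isCompact_closedBall (0 : Plane) R) isClosed_empty (Set.disjoint_empty _)
  have hφc : HasCompactSupport fun x => χ x * u x := hχc.mul_right
  have hφcont : Continuous fun x => χ x * u x := χ.continuous.mul hu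
  let φ : C₀(Plane, ℝ) := ⟨⟨fun x => χ x * u x, hφcont⟩, hφc.is_zero_at_infty⟩
  obtain ⟨C, hC⟩ := hφc.exists_bound_of_continuous hφcont
  have h := hlim φ
  have hint : Integrable fun x => f x * φ x :=
    hfi.mul_bdd hφcont.aestronglyMeasurable (Eventually.of_forall hC)
  rw [densityMeasure, VectorMeasure.integral_withDensityᵥ hfi hint] at h
  have hlim_eq : ∫ x, f x * φ x = ∫ x, f x * u x := by
    refine integral_congr_ae ?_
    filter_upwards [hf] with x hx
    by_cases hxR : x ∈ Metric.closedBall (0 : Plane) R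
    · change f x * (χ x * u x) = _
      rw [hχ1 hxR]
      simp
    · simp [hx hxR]
  rw [hlim_eq] at h
  refine h.congr fun N => ?_
  beta_reduce
  rw [empiricalMeasure_eq_toSignedMeasure, ← lsmul_flip_real,
    VectorMeasure.integral_toSignedMeasure]
  refine integral_congr_ae (ae_posEmpiricalMeasure (q N) fun i => ?_)
  change χ _ * u _ = _
  rw [hχ1 (hqR N i)]
  simp

theorem abs_integral_kernelPotential_posEmpiricalMeasure_le {G : Plane → ℝ} (hG : MemLp G 2)
    (hf : MemLp f 2) {N : ℕ} (q : Fin N → Plane) :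
    |∫ x, kernelPotential G f x ∂(posEmpiricalMeasure q)| ≤
      (eLpNorm G 2).toReal * (eLpNorm f 2).toReal := by
  have h := abs_integral_mul_kernelPotential_le (ν := posEmpiricalMeasure q) hG hf
    (integrable_const (1 : ℝ))
  simp only [one_mul] at h
  refine h.trans (mul_le_of_le_one_left (by positivity) ?_)
  rw [integral_posEmpiricalMeasure]
  simp only [norm_one, Finset.sum_const, Finset.card_univ, Fintype.card_fin, nsmul_eq_mul, mul_one]
  -- The total mass is at most 1; it is 0 when N = 0.
  exact inv_mul_le_one

theorem tendsto_mul_zero_of_tendsto_zero {a : ℕ → ℝ} (ha : Tendsto a atTop (𝓝 0)) (c : ℝ) :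
    Tendsto (fun N => c * a N) atTop (𝓝 0) := by
  simpa using ha.const_mul c

/-- Weak-* convergence handles the fixed potential of `f`; that of `h N` tends to 0 uniformly on the
plane, whatever the points. -/
theorem WeakStarTendsto.tendsto_integral_kernelPotential_add {G : Plane → ℝ}
    {q : (N : ℕ) → Fin N → Plane} {h : ℕ → Plane → ℝ}
    (hlim : WeakStarTendsto (fun N => empiricalMeasure (q N)) (densityMeasure f))
    (hG : MemLp G 2) (hf2 : MemLp f 2) (hf : EssSupportSubset f (Metric.closedBall 0 R))
    (hqR : ∀ N i, q N i ∈ Metric.closedBall 0 R) (hh2 : ∀ N, MemLp (h N) 2)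
    (hh_lim : Tendsto (fun N => (eLpNorm (h N) 2).toReal) atTop (𝓝 0)) :
    Tendsto (fun N => ∫ x, kernelPotential G (f + h N) x ∂(posEmpiricalMeasure (q N))) atTop
      (𝓝 (∫ x, f x * kernelPotential G f x)) := by
  have hpot_lim : Tendsto (fun N => ∫ x, kernelPotential G (h N) x ∂(posEmpiricalMeasure (q N)))
      atTop (𝓝 0) :=
    squeeze_zero_norm (fun N =>
      abs_integral_kernelPotential_posEmpiricalMeasure_le hG (hh2 N) (q N))
      (tendsto_mul_zero_of_tendsto_zero hh_lim _)
  have key : ∀ N, ∫ x, kernelPotential G (f + h N) x ∂(posEmpiricalMeasure (q N)) =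
      (∫ x, kernelPotential G f x ∂(posEmpiricalMeasure (q N))) +
      ∫ x, kernelPotential G (h N) x ∂(posEmpiricalMeasure (q N)) := by
    intro N
    rw [← integral_add (integrable_posEmpiricalMeasure _ _) (integrable_posEmpiricalMeasure _ _)]
    simp only [kernelPotential_add hG hf2 (hh2 N)]
  simp only [key]
  have hsum := (hlim.tendsto_integral_posEmpiricalMeasure (hf2.integrable_of_essSupportSubset hf)
    hf hqR (continuous_kernelPotential hG hf2)).add hpot_lim
  rwa [add_zero] at hsum

/-- The interaction energy is continuous for the `L²` topology, on functions with supports in a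
fixed ball. -/
theorem tendsto_integral_mul_kernelPotential_add {G : Plane → ℝ} {h : ℕ → Plane → ℝ}
    (hG : MemLp G 2) (hf2 : MemLp f 2) (hf : EssSupportSubset f (Metric.closedBall 0 R))
    (hh2 : ∀ N, MemLp (h N) 2) (hh : ∀ N, EssSupportSubset (h N) (Metric.closedBall 0 R))
    (hh_lim : Tendsto (fun N => (eLpNorm (h N) 2).toReal) atTop (𝓝 0)) :
    Tendsto (fun N => ∫ x, (f + h N) x * kernelPotential G (f + h N) x) atTop
      (𝓝 (∫ x, f x * kernelPotential G f x)) := by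
  have hfi := hf2.integrable_of_essSupportSubset hf
  have hhi : ∀ N, Integrable (h N) := fun N => (hh2 N).integrable_of_essSupportSubset (hh N)
  have hfh_lim : Tendsto (fun N => ∫ x, f x * kernelPotential G (h N) x) atTop (𝓝 0) :=
    squeeze_zero_norm (fun N => abs_integral_mul_kernelPotential_le hG (hh2 N) hfi)
      (tendsto_mul_zero_of_tendsto_zero (tendsto_mul_zero_of_tendsto_zero hh_lim _) _)
  have hh1_lim : Tendsto (fun N => ∫ x, ‖h N x‖) atTop (𝓝 0) :=
    squeeze_zero (fun N => integral_nonneg fun x => norm_nonneg _)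
      (fun N => integral_norm_le_of_essSupportSubset (hh2 N) (hh N))
      (tendsto_mul_zero_of_tendsto_zero hh_lim _)
  have hhf_lim : Tendsto (fun N => ∫ x, h N x * kernelPotential G f x) atTop (𝓝 0) := by
    refine squeeze_zero_norm (fun N => abs_integral_mul_kernelPotential_le hG hf2 (hhi N)) ?_
    simp only [mul_comm (∫ x, ‖h _ x‖)]
    exact tendsto_mul_zero_of_tendsto_zero hh1_lim _
  have hhh_lim : Tendsto (fun N => ∫ x, h N x * kernelPotential G (h N) x) atTop (𝓝 0) := by
    refine squeeze_zero_norm (fun N => abs_integral_mul_kernelPotential_le hG (hh2 N) (hhi N)) ?_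
    have hmul := hh1_lim.mul (tendsto_mul_zero_of_tendsto_zero hh_lim (eLpNorm G 2).toReal)
    rwa [mul_zero] at hmul
  -- Bilinear expansion: every term but the first contains `h N` and tends to 0.
  have key : ∀ N, ∫ x, (f + h N) x * kernelPotential G (f + h N) x =
      ((∫ x, f x * kernelPotential G f x) + ∫ x, f x * kernelPotential G (h N) x) +
      ((∫ x, h N x * kernelPotential G f x) + ∫ x, h N x * kernelPotential G (h N) x) := by
    intro N
    have i1 := integrable_mul_kernelPotential hG hf2 hfi
    have i2 := integrable_mul_kernelPotential hG (hh2 N) hfi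
    have i3 := integrable_mul_kernelPotential hG hf2 (hhi N)
    have i4 := integrable_mul_kernelPotential hG (hh2 N) (hhi N)
    rw [← integral_add' i1 i2, ← integral_add' i3 i4, ← integral_add' (i1.add i2) (i3.add i4)]
    refine integral_congr_ae (Eventually.of_forall fun x => ?_)
    simp only [kernelPotential_add hG hf2 (hh2 N), Pi.add_apply]
    ring
  simp only [key]
  have hsum := (hfh_lim.const_add (∫ x, f x * kernelPotential G f x)).add (hhf_lim.add hhh_lim)
  rwa [add_zero, add_zero, add_zero] at hsum

end Limit

/-! ### Assembly of the three limits. -/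

theorem proposition1p7
    (ω₀ ρ₀ : Plane → ℝ) (ω : ℕ → Plane → ℝ) (q : (N : ℕ) → Fin N → Plane) (K : Set Plane)
    (hω₀ : MemLp ω₀ 2 volume) (hω₀_supp : HasCompactEssSupport ω₀)
    (hρ₀ : MemLp ρ₀ 2 volume) (hρ₀_supp : HasCompactEssSupport ρ₀)
    (hω : ∀ N, MemLp (ω N) 2 volume)
    (hq : ∀ N, Function.Injective (q N))
    (hK : IsCompact K)
    (hω_supp : ∀ N, EssSupportSubset (ω N) K)
    (hq_supp : ∀ N i, q N i ∈ K)
    (hω_lim : Tendsto (fun N => eLpNorm (ω N - ω₀) 2 volume) atTop (𝓝 0))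
    (hρ_lim : WeakStarTendsto (fun N => empiricalMeasure (q N)) (densityMeasure ρ₀))
    (henergy_lim : Tendsto
      (fun N : ℕ => 1 / (N : ℝ) ^ 2 *
        ∑ p ∈ (Finset.univ : Finset (Fin N)).offDiag, greenKernel (q N p.1 - q N p.2))
      atTop
      (𝓝 (∫ p : Plane × Plane, greenKernel (p.1 - p.2) * ρ₀ p.1 * ρ₀ p.2))) :
    (∀ N, HasFiniteCoulombEnergy (densityMeasure ρ₀ + densityMeasure ω₀
        - empiricalMeasure (q N) - densityMeasure (ω N))) ∧
    Tendsto (fun N => coulombEnergy (densityMeasure ρ₀ + densityMeasure ω₀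
        - empiricalMeasure (q N) - densityMeasure (ω N))) atTop (𝓝 0) := by
  obtain ⟨K₁, hK₁, hω₀K⟩ := hω₀_supp
  obtain ⟨K₂, hK₂, hρ₀K⟩ := hρ₀_supp
  obtain ⟨R, hR⟩ := ((hK.union hK₁).union hK₂).isBounded.subset_closedBall (0 : Plane)
  have hKR : K ⊆ Metric.closedBall 0 R := fun x hx => hR (Or.inl (Or.inl hx))
  have hω₀R := hω₀K.mono fun x hx => hR (Or.inl (Or.inr hx))
  have hρ₀R := hρ₀K.mono fun x hx => hR (Or.inr hx)
  have hωR := fun N => (hω_supp N).mono hKR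
  have hqR := fun N i => hKR (hq_supp N i)
  have hρ₀i := hρ₀.integrable_of_essSupportSubset hρ₀R
  have hω₀i := hω₀.integrable_of_essSupportSubset hω₀R
  have hωi := fun N => (hω N).integrable_of_essSupportSubset (hωR N)
  obtain ⟨h, hh⟩ : ∃ h : ℕ → Plane → ℝ, ∀ N, h N = ω₀ - ω N := ⟨_, fun _ => rfl⟩
  have hh2 : ∀ N, MemLp (h N) 2 := fun N => hh N ▸ hω₀.sub (hω N)
  have hhR : ∀ N, EssSupportSubset (h N) (Metric.closedBall 0 R) := fun N => by
    filter_upwards [hω₀R, hωR N] with x h1 h2 hx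
    simp [hh N, h1 hx, h2 hx]
  have hhi : ∀ N, Integrable (h N) := fun N => (hh2 N).integrable_of_essSupportSubset (hhR N)
  have hf2 : ∀ N, MemLp (ρ₀ + h N) 2 := fun N => hρ₀.add (hh2 N)
  have hfR : ∀ N, EssSupportSubset (ρ₀ + h N) (Metric.closedBall 0 R) := fun N => by
    filter_upwards [hρ₀R, hhR N] with x h1 h2 hx
    simp [h1 hx, h2 hx]
  -- All absolutely continuous parts merge into the single density `ρ₀ + h N`.
  have hσ : ∀ N, densityMeasure ρ₀ + densityMeasure ω₀ - empiricalMeasure (q N)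
      - densityMeasure (ω N) = densityMeasure (ρ₀ + h N) - empiricalMeasure (q N) := fun N => by
    have : densityMeasure (ρ₀ + h N) =
        densityMeasure ρ₀ + (densityMeasure ω₀ - densityMeasure (ω N)) := by
      simp only [densityMeasure]
      rw [withDensityᵥ_add hρ₀i (hhi N), hh N, withDensityᵥ_sub hω₀i (hωi N)]
    rw [this]
    abel
  have hE := fun N => coulombEnergy_density_sub_empirical (hf2 N) (hfR N) (hq N) (hqR N)
  simp only [hσ]
  refine ⟨fun N => (hE N).1, ?_⟩
  simp only [fun N => (hE N).2]
  obtain ⟨G, hGdef⟩ : ∃ G, G = truncatedGreenKernel (2 * R) := ⟨_, rfl⟩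
  have hG : MemLp G 2 := hGdef ▸ memLp_truncatedGreenKernel _
  have hI : ∫ p : Plane × Plane, greenKernel (p.1 - p.2) * ρ₀ p.1 * ρ₀ p.2 =
      ∫ x, ρ₀ x * kernelPotential G ρ₀ x := by
    rw [hGdef, ← integral_mul_greenKernel hρ₀ hρ₀R hρ₀i hρ₀R]
    refine integral_congr_ae (Eventually.of_forall fun p => ?_)
    simp only
    ring
  rw [hI] at henergy_lim
  rw [← hGdef]
  have hh_lim : Tendsto (fun N => (eLpNorm (h N) 2).toReal) atTop (𝓝 0) := by
    rw [← ENNReal.toReal_zero]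
    refine (ENNReal.tendsto_toReal (by simp)).comp (hω_lim.congr fun N => ?_)
    rw [hh N, eLpNorm_sub_comm]
  have hself_lim := tendsto_integral_mul_kernelPotential_add hG hρ₀ hρ₀R hh2 hhR hh_lim
  have hcross_lim := hρ_lim.tendsto_integral_kernelPotential_add hG hρ₀ hρ₀R hqR hh2 hh_lim
  have hfinal := (hself_lim.sub (hcross_lim.const_mul 2)).add henergy_lim
  -- The limit is I - 2I + I = 0.
  refine hfinal.trans (le_of_eq ?_)
  congr 1
  ring
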